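/- A finite simple graph $H$ is a minor of a graph $G$ if (up to isomorphism) it can be obtained from $G$ by a finite sequence of edge deletions, vertex deletions and edge contractions. For a real number $m$, a graph $G$ is called $m$-minor-universal if every finite simple graph $H$ with at most $m$ edges and no isolated vertices is a minor of $G$. Let $Q_d$ be the $d$-dimensional hypercube, whose vertices are the binary strings of length $d$, two of them being adjacent when their Hamming distance is one. **Theorem.** There is an absolute constant $C>0$ such that, for every integer $d\ge 1$, the hypercube $Q_d$ is not $\frac{C\cdot 2^d}{d}$-minor-universal; that is, some finite simple graph with at most $\frac{C\cdot 2^d}{d}$ edges and no isolated vertices is not a minor of $Q_d$. -/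

import Mathlib

universe u

/-- The graph `G / uv`: the vertex `v` is merged into `u`; loops and multiple edges disappear.
This is the contraction of the edge `uv` when `u` and `v` are adjacent. -/
def SimpleGraph.contractEdge {V : Type u} (G : SimpleGraph V) (u v : V) :
    SimpleGraph {w : V // w ≠ v} where
  Adj a b := a ≠ b ∧
    (G.Adj a b ∨ ((a : V) = u ∧ G.Adj v b) ∨ ((b : V) = u ∧ G.Adj a v))
  symm := ⟨by
    rintro a b ⟨hab, h | ⟨h, h'⟩ | ⟨h, h'⟩⟩
    · exact ⟨hab.symm, Or.inl h.symm⟩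
    · exact ⟨hab.symm, Or.inr (Or.inr ⟨h, h'.symm⟩)⟩
    · exact ⟨hab.symm, Or.inr (Or.inl ⟨h, h'.symm⟩)⟩⟩
  loopless := ⟨fun _ h => h.1 rfl⟩

/-- `G.HasMinor H`: the graph `H` can be obtained, up to isomorphism, from `G` by a finite
sequence of edge deletions, vertex deletions and edge contractions. -/
inductive SimpleGraph.HasMinor {V : Type u} (G : SimpleGraph V) :
    ∀ {W : Type u}, SimpleGraph W → Prop
  | refl : HasMinor G G
  | iso {W W' : Type u} {H : SimpleGraph W} {H' : SimpleGraph W'} (e : H ≃g H') :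
      HasMinor G H → HasMinor G H'
  | deleteEdge {W : Type u} {H : SimpleGraph W} (e : Sym2 W) :
      HasMinor G H → HasMinor G (H.deleteEdges {e})
  | deleteVertex {W : Type u} {H : SimpleGraph W} (v : W) :
      HasMinor G H → HasMinor G (H.induce {w : W | w ≠ v})
  | contractEdge {W : Type u} {H : SimpleGraph W} (u v : W) (huv : H.Adj u v) :
      HasMinor G H → HasMinor G (H.contractEdge u v)

/-- `G` is `m`-minor-universal if every (finite) graph with at most `m` edges and no isolated
vertices is a minor of `G`. -/
def SimpleGraph.IsMinorUniversal {V : Type u} (G : SimpleGraph V) (m : ℝ) : Prop :=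
  ∀ (W : Type u) [Finite W] (H : SimpleGraph W),
    (H.edgeSet.ncard : ℝ) ≤ m → (∀ w, ¬ H.IsIsolated w) → G.HasMinor H

/-- The `d`-dimensional hypercube `Q_d`: binary strings of length `d`, adjacent when their
Hamming distance is one. -/
def hypercube (d : ℕ) : SimpleGraph (Fin d → Bool) where
  Adj x y := hammingDist x y = 1
  symm := ⟨fun x y h => by rw [hammingDist_comm]; exact h⟩
  loopless := ⟨fun x h => by simp at h⟩

/-! The proof counts. Take unions of `k = 4` perfect matchings on `n + n` vertices, with `n` of
order `2^d / d`. In a minor model, pick one root per branch set: adjacent roots are closer than the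
sum of their branch set sizes, so root distances over all matching edges total at most `k * 2^d`.
For fixed roots, the weight enumerator `(1 + x)^d` shows that few tuples of permutations are this
cheap; there are at most `2^(2dn)` choices of roots. Hence `factorial_pow_le_of_forall_hasMinor`,
which fails at `x = 1/4`: `(n!)^4` is roughly `16^(dn)`, the right side is below `9.8^(dn)`, and
`x^(k * 2^d)` costs at most `1.1^(dn)`. -/

/-- A weak form of a minor model in the hypercube: disjoint nonempty branch sets whose Hamming
diameter is smaller than their cardinality, with adjacent vertices having branch sets at Hamming
distance at most one. -/
structure HammingModel {d : ℕ} {W : Type} (H : SimpleGraph W)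
    (B : W → Finset (Fin d → Bool)) : Prop where
  nonempty : ∀ w, (B w).Nonempty
  disjoint : ∀ u v, u ≠ v → Disjoint (B u) (B v)
  diam_lt : ∀ w, ∀ x ∈ B w, ∀ y ∈ B w, hammingDist x y < (B w).card
  adj : ∀ u v, H.Adj u v → ∃ x ∈ B u, ∃ y ∈ B v, hammingDist x y ≤ 1

namespace HammingModel

variable {d : ℕ} {W : Type} {H : SimpleGraph W} {B : W → Finset (Fin d → Bool)}

/-- Crossing one edge costs `(a - 1) + 1 + (b - 1) < a + b`, so the strict bound `diam_lt` survives
contraction. -/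
theorem dist_lt (hB : HammingModel H B) {u v : W} (huv : H.Adj u v) {x y : Fin d → Bool}
    (hx : x ∈ B u) (hy : y ∈ B v) : hammingDist x y < (B u).card + (B v).card := by
  obtain ⟨a, ha, b, hb, hab⟩ := hB.adj u v huv
  have h1 := hB.diam_lt u x hx a ha
  have h2 := hB.diam_lt v b hb y hy
  have h3 := hammingDist_triangle x a y
  have h4 := hammingDist_triangle a b y
  omega

theorem comap (hB : HammingModel H B) {W' : Type} {H' : SimpleGraph W'} {f : W' → W}
    (hf : Function.Injective f) (hadj : ∀ u v, H'.Adj u v → H.Adj (f u) (f v)) :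
    HammingModel H' (B ∘ f) where
  nonempty w := hB.nonempty (f w)
  disjoint _ _ huv := hB.disjoint _ _ (hf.ne huv)
  diam_lt w := hB.diam_lt (f w)
  adj u v huv := hB.adj _ _ (hadj u v huv)

open Classical in
theorem contractEdge (hB : HammingModel H B) {u v : W} (huv : H.Adj u v) :
    HammingModel (H.contractEdge u v)
      (fun w => if (w : W) = u then B u ∪ B v else B w) where
  nonempty w := by
    split_ifs
    · exact (hB.nonempty u).mono Finset.subset_union_left
    · exact hB.nonempty _
  disjoint a b hab := by
    have hab' : (a : W) ≠ b := fun h => hab (Subtype.ext h)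
    split_ifs with h1 h2 h2
    · exact absurd (h1.trans h2.symm) hab'
    · exact Finset.disjoint_union_left.2
        ⟨hB.disjoint _ _ (Ne.symm h2), hB.disjoint _ _ b.2.symm⟩
    · exact Finset.disjoint_union_right.2 ⟨hB.disjoint _ _ h1, hB.disjoint _ _ a.2⟩
    · exact hB.disjoint _ _ hab'
  diam_lt w := by
    split_ifs
    · rw [Finset.card_union_of_disjoint (hB.disjoint _ _ huv.ne)]
      intro x hx y hy
      rcases Finset.mem_union.1 hx with hx | hx <;> rcases Finset.mem_union.1 hy with hy | hy
      · exact (hB.diam_lt u x hx y hy).trans_le (Nat.le_add_right _ _)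
      · exact hB.dist_lt huv hx hy
      · rw [hammingDist_comm]
        exact hB.dist_lt huv hy hx
      · exact (hB.diam_lt v x hx y hy).trans_le (Nat.le_add_left _ _)
    · exact hB.diam_lt _
  adj a b hab := by
    have key : ∀ w : {w : W // w ≠ v},
        B w ⊆ (if (w : W) = u then B u ∪ B v else B w) := by
      intro w
      split_ifs with h
      · rw [h]
        exact Finset.subset_union_left
      · exact subset_rfl
    obtain ⟨-, h | ⟨h, h'⟩ | ⟨h, h'⟩⟩ := hab
    · obtain ⟨x, hx, y, hy, hxy⟩ := hB.adj _ _ h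
      exact ⟨x, key a hx, y, key b hy, hxy⟩
    · obtain ⟨x, hx, y, hy, hxy⟩ := hB.adj _ _ h'
      refine ⟨x, ?_, y, key b hy, hxy⟩
      rw [if_pos h]
      exact Finset.mem_union_right _ hx
    · obtain ⟨x, hx, y, hy, hxy⟩ := hB.adj _ _ h'
      refine ⟨x, key a hx, y, ?_, hxy⟩
      rw [if_pos h]
      exact Finset.mem_union_right _ hy

theorem sum_card_le [Fintype W] (hB : HammingModel H B) : ∑ w, (B w).card ≤ 2 ^ d := by
  classical
  rw [← Finset.card_biUnion fun u _ v _ huv => hB.disjoint u v huv]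
  exact (Finset.card_le_univ _).trans_eq (by simp)

end HammingModel

theorem exists_hammingModel_of_hasMinor {d : ℕ} {W : Type} {H : SimpleGraph W}
    (h : (hypercube d).HasMinor H) : ∃ B : W → Finset (Fin d → Bool), HammingModel H B := by
  induction h with
  | refl =>
    refine ⟨fun w => {w}, fun w => by simp, fun u v huv => by simpa using huv,
      fun w x hx y hy => ?_, fun u v huv => ⟨u, by simp, v, by simp, le_of_eq huv⟩⟩
    rw [Finset.mem_singleton.1 hx, Finset.mem_singleton.1 hy]
    simp
  | iso e _ ih =>
    obtain ⟨B, hB⟩ := ih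
    exact ⟨_, hB.comap e.symm.injective fun u v huv => e.symm.map_adj_iff.2 huv⟩
  | deleteEdge e _ ih =>
    obtain ⟨B, hB⟩ := ih
    exact ⟨_, hB.comap Function.injective_id fun u v huv => SimpleGraph.deleteEdges_le _ huv⟩
  | deleteVertex v _ ih =>
    obtain ⟨B, hB⟩ := ih
    exact ⟨_, hB.comap Subtype.val_injective fun u v huv => huv⟩
  | contractEdge u v huv _ ih =>
    obtain ⟨B, hB⟩ := ih
    exact ⟨_, hB.contractEdge huv⟩

/-- The bipartite graph on two copies of `Fin n` which is the union of the perfect matchings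
given by the permutations `σ t`. -/
def permGraph {k n : ℕ} (σ : Fin k → Equiv.Perm (Fin n)) : SimpleGraph (Fin n ⊕ Fin n) :=
  SimpleGraph.fromRel fun a b => ∃ t i, a = Sum.inl i ∧ b = Sum.inr (σ t i)

theorem permGraph_adj {k n : ℕ} (σ : Fin k → Equiv.Perm (Fin n)) (t : Fin k) (i : Fin n) :
    (permGraph σ).Adj (Sum.inl i) (Sum.inr (σ t i)) :=
  (SimpleGraph.fromRel_adj _ _ _).2 ⟨by simp, Or.inl ⟨t, i, rfl, rfl⟩⟩

theorem not_isIsolated_permGraph {k n : ℕ} [NeZero k] (σ : Fin k → Equiv.Perm (Fin n))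
    (w : Fin n ⊕ Fin n) : ¬ (permGraph σ).IsIsolated w := by
  intro h
  rcases w with i | j
  · exact h _ (permGraph_adj σ 0 i)
  · have := permGraph_adj σ 0 ((σ 0).symm j)
    rw [Equiv.apply_symm_apply] at this
    exact h _ this.symm

theorem ncard_edgeSet_permGraph_le {k n : ℕ} (σ : Fin k → Equiv.Perm (Fin n)) :
    (permGraph σ).edgeSet.ncard ≤ k * n := by
  have hsub : (permGraph σ).edgeSet ⊆
      Set.range fun p : Fin k × Fin n => s(Sum.inl p.2, Sum.inr (σ p.1 p.2)) := by
    intro e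
    induction e with
    | _ a b =>
      intro h
      obtain ⟨-, ⟨t, i, rfl, rfl⟩ | ⟨t, i, rfl, rfl⟩⟩ := (SimpleGraph.fromRel_adj _ _ _).1
        ((permGraph σ).mem_edgeSet.1 h)
      · exact ⟨(t, i), rfl⟩
      · exact ⟨(t, i), Sym2.eq_swap⟩
  calc _ ≤ _ := Set.ncard_le_ncard hsub (Set.finite_range _)
    _ = (Set.image (fun p : Fin k × Fin n => (s(Sum.inl p.2, Sum.inr (σ p.1 p.2)) :
          Sym2 (Fin n ⊕ Fin n))) Set.univ).ncard := by rw [Set.image_univ]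
    _ ≤ (Set.univ : Set (Fin k × Fin n)).ncard := Set.ncard_image_le Set.finite_univ
    _ = k * n := by simp [Set.ncard_univ]

/-- Each matching meets every vertex once, so summing branch set sizes over its edges counts each
set once. -/
theorem exists_roots_of_hasMinor_permGraph {d k n : ℕ} {σ : Fin k → Equiv.Perm (Fin n)}
    (h : (hypercube d).HasMinor (permGraph σ)) :
    ∃ r : Fin n ⊕ Fin n → Fin d → Bool, Function.Injective r ∧
      ∑ p : Fin k × Fin n, hammingDist (r (Sum.inl p.2)) (r (Sum.inr (σ p.1 p.2)))
        ≤ k * 2 ^ d := by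
  obtain ⟨B, hB⟩ := exists_hammingModel_of_hasMinor h
  choose r hr using hB.nonempty
  refine ⟨r, fun u v huv => ?_, ?_⟩
  · by_contra hne
    exact Finset.disjoint_left.1 (hB.disjoint u v hne) (hr u) (huv ▸ hr v)
  · calc _ ≤ ∑ p : Fin k × Fin n,
          ((B (Sum.inl p.2)).card + (B (Sum.inr (σ p.1 p.2))).card) :=
        Finset.sum_le_sum fun p _ => (hB.dist_lt (permGraph_adj σ p.1 p.2) (hr _) (hr _)).le
      _ = ∑ t : Fin k, ∑ w, (B w).card := by
        rw [Fintype.sum_prod_type]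
        refine Finset.sum_congr rfl fun t _ => ?_
        rw [Finset.sum_add_distrib, Fintype.sum_sum_type]
        congr 1
        exact Equiv.sum_comp (σ t) fun j => (B (Sum.inr j)).card
      _ ≤ ∑ _t : Fin k, 2 ^ d := Finset.sum_le_sum fun _ _ => hB.sum_card_le
      _ = k * 2 ^ d := by simp

/-- The weight enumerator of the hypercube. -/
theorem sum_pow_hammingDist {R : Type*} [CommSemiring R] {d : ℕ} (p : Fin d → Bool) (x : R) :
    ∑ q : Fin d → Bool, x ^ hammingDist p q = (1 + x) ^ d := by
  have h : ∀ q : Fin d → Bool,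
      x ^ hammingDist p q = ∏ i, (if p i ≠ q i then x else 1) := by
    intro q
    rw [Finset.prod_ite, Finset.prod_const, Finset.prod_const_one, mul_one]
    rfl
  have h2 : ∀ i, ∑ b : Bool, (if p i ≠ b then x else 1) = 1 + x := by
    intro i
    cases p i <;> simp [add_comm]
  simp_rw [h]
  rw [← Fintype.prod_sum (fun i (b : Bool) => if p i ≠ b then x else 1)]
  rw [Finset.prod_congr rfl fun i _ => h2 i]
  simp

/-- Enlarging the sum to arbitrary functions into the cube makes it factor over pairs `(t, i)`. -/
theorem sum_perm_pow_hammingDist_le {d k n : ℕ} {r : Fin n ⊕ Fin n → Fin d → Bool}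
    (hr : Function.Injective r) {x : ℝ} (hx : 0 ≤ x) :
    ∑ σ : Fin k → Equiv.Perm (Fin n),
      x ^ (∑ p : Fin k × Fin n, hammingDist (r (Sum.inl p.2)) (r (Sum.inr (σ p.1 p.2))))
        ≤ (1 + x) ^ (d * (k * n)) := by
  let φ : (Fin k → Equiv.Perm (Fin n)) → Fin k × Fin n → Fin d → Bool :=
    fun σ p => r (Sum.inr (σ p.1 p.2))
  have hφ : Function.Injective φ := by
    intro σ τ h
    funext t
    ext i : 1
    exact Sum.inr_injective (hr (congrFun h (t, i)))
  let F : (Fin k × Fin n → Fin d → Bool) → ℝ :=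
    fun f => ∏ p, x ^ hammingDist (r (Sum.inl p.2)) (f p)
  have hF : ∀ f, 0 ≤ F f := fun f => Finset.prod_nonneg fun p _ => pow_nonneg hx _
  calc _ = ∑ σ, F (φ σ) := Finset.sum_congr rfl fun σ _ => (Finset.prod_pow_eq_pow_sum _ _ _).symm
    _ = ∑ f ∈ Finset.univ.map ⟨φ, hφ⟩, F f := by rw [Finset.sum_map]; rfl
    _ ≤ ∑ f, F f :=
      Finset.sum_le_sum_of_subset_of_nonneg (Finset.subset_univ _) fun f _ _ => hF f
    _ = ∏ p : Fin k × Fin n, ∑ q, x ^ hammingDist (r (Sum.inl p.2)) q :=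
      (Fintype.prod_sum fun (p : Fin k × Fin n) q => x ^ hammingDist (r (Sum.inl p.2)) q).symm
    _ = (1 + x) ^ (d * (k * n)) := by simp [sum_pow_hammingDist, pow_mul]

/-- If all unions of `k` perfect matchings on `n + n` vertices are minors of the hypercube, then
there are few of them. -/
theorem factorial_pow_le_of_forall_hasMinor {d k n : ℕ}
    (h : ∀ σ : Fin k → Equiv.Perm (Fin n), (hypercube d).HasMinor (permGraph σ))
    {x : ℝ} (hx : 0 < x) (hx1 : x ≤ 1) :
    (n.factorial : ℝ) ^ k * x ^ (k * 2 ^ d) ≤ 2 ^ (d * (n + n)) * (1 + x) ^ (d * (k * n)) := by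
  classical
  choose r hr hsum using fun σ => exists_roots_of_hasMinor_permGraph (h σ)
  let S : Finset (Fin n ⊕ Fin n → Fin d → Bool) := Finset.univ.filter Function.Injective
  let E : (Fin n ⊕ Fin n → Fin d → Bool) → (Fin k → Equiv.Perm (Fin n)) → ℕ := fun r σ =>
    ∑ p : Fin k × Fin n, hammingDist (r (Sum.inl p.2)) (r (Sum.inr (σ p.1 p.2)))
  calc (n.factorial : ℝ) ^ k * x ^ (k * 2 ^ d)
      = ∑ _σ : Fin k → Equiv.Perm (Fin n), x ^ (k * 2 ^ d) := by
        simp [Fintype.card_perm]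
    _ ≤ ∑ σ, x ^ E (r σ) σ :=
        Finset.sum_le_sum fun σ _ => pow_le_pow_of_le_one hx.le hx1 (hsum σ)
    _ ≤ ∑ σ, ∑ s ∈ S, x ^ E s σ :=
        Finset.sum_le_sum fun σ _ =>
          Finset.single_le_sum (f := fun s => x ^ E s σ) (fun s _ => pow_nonneg hx.le _)
            (Finset.mem_filter.2 ⟨Finset.mem_univ _, hr σ⟩)
    _ = ∑ s ∈ S, ∑ σ, x ^ E s σ := Finset.sum_comm
    _ ≤ ∑ _s ∈ S, (1 + x) ^ (d * (k * n)) :=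
        Finset.sum_le_sum fun s hs =>
          sum_perm_pow_hammingDist_le (Finset.mem_filter.1 hs).2 hx.le
    _ = S.card * (1 + x) ^ (d * (k * n)) := by simp
    _ ≤ 2 ^ (d * (n + n)) * (1 + x) ^ (d * (k * n)) := by
        gcongr
        have : S.card ≤ 2 ^ (d * (n + n)) :=
          (Finset.card_le_univ S).trans_eq (by simp [pow_mul])
        exact_mod_cast this

theorem div_three_pow_le_factorial (n : ℕ) : ((n : ℝ) / 3) ^ n ≤ n.factorial := by
  have h1 := Real.pow_div_factorial_le_exp (n : ℝ) n.cast_nonneg n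
  have h2 : Real.exp n ≤ 3 ^ n := by
    rw [← Real.exp_one_pow]
    exact pow_le_pow_left₀ (Real.exp_pos _).le (Real.exp_one_lt_d9.le.trans (by norm_num)) _
  rw [div_le_iff₀ (by positivity)] at h1
  rw [div_pow, div_le_iff₀ (by positivity), mul_comm]
  exact h1.trans (by gcongr)

theorem not_forall_hasMinor_permGraph {d n : ℕ} (hn0 : n ≠ 0) (hn : 64 * 2 ^ d ≤ d * n) :
    ¬ ∀ σ : Fin 4 → Equiv.Perm (Fin n), (hypercube d).HasMinor (permGraph σ) := by
  intro h
  have h1 := factorial_pow_le_of_forall_hasMinor h (x := 1 / 4) (by norm_num) (by norm_num)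
  -- The constant 64 is `4 * 16`, with 16 chosen so that `1.1 ^ 16 > 4`.
  have h2 : (1 / 1.1 : ℝ) ^ (d * n) ≤ (1 / 4) ^ (4 * 2 ^ d) :=
    calc (1 / 1.1 : ℝ) ^ (d * n) ≤ (1 / 1.1) ^ (64 * 2 ^ d) :=
          pow_le_pow_of_le_one (by norm_num) (by norm_num) hn
      _ = ((1 / 1.1) ^ 16) ^ (4 * 2 ^ d) := by rw [← pow_mul]; congr 1; ring
      _ ≤ (1 / 4) ^ (4 * 2 ^ d) := by gcongr; norm_num
  have h3 : (((n : ℝ) / 3) ^ 4 * (1 / 1.1) ^ d) ^ n ≤ (4 ^ d * ((1 + 1 / 4) ^ 4) ^ d) ^ n :=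
    calc (((n : ℝ) / 3) ^ 4 * (1 / 1.1) ^ d) ^ n
        = (((n : ℝ) / 3) ^ n) ^ 4 * (1 / 1.1) ^ (d * n) := by
          rw [mul_pow, ← pow_mul, ← pow_mul, ← pow_mul, mul_comm 4 n]
      _ ≤ (n.factorial : ℝ) ^ 4 * (1 / 4) ^ (4 * 2 ^ d) := by
          gcongr
          exact div_three_pow_le_factorial n
      _ ≤ _ := h1
      _ = (4 ^ d * ((1 + 1 / 4) ^ 4) ^ d) ^ n := by
          rw [mul_pow, show (4 : ℝ) = 2 ^ 2 by norm_num, ← pow_mul, ← pow_mul, ← pow_mul,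
            ← pow_mul]
          congr 2 <;> ring
  have h4 := le_of_pow_le_pow_left₀ hn0 (by positivity) h3
  have h5 : (d : ℝ) < 10 * 1.1 ^ d := by
    have := one_add_mul_le_pow (a := (0.1 : ℝ)) (by norm_num) d
    norm_num at this ⊢
    linarith
  have hd : 0 < d := Nat.pos_of_ne_zero fun h0 => by simp [h0] at hn
  have h6 : (2 / 1.1 : ℝ) ^ d < n / 3 := by
    have hnR : (64 : ℝ) * 2 ^ d ≤ d * n := by exact_mod_cast hn
    have h7 : (2 / 1.1 : ℝ) ^ d * 1.1 ^ d = 2 ^ d := by rw [← mul_pow]; norm_num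
    have h8 : (0 : ℝ) < (2 / 1.1 : ℝ) ^ d := by positivity
    have h9 : (d : ℝ) * ((2 / 1.1 : ℝ) ^ d) < d * (n / 3) := by
      have := mul_lt_mul_of_pos_left h5 h8
      have h10 : (0 : ℝ) < 2 ^ d := by positivity
      nlinarith
    exact lt_of_mul_lt_mul_left h9 (Nat.cast_nonneg d)
  have h11 : ((2 / 1.1 : ℝ) ^ d) ^ 4 < (n / 3) ^ 4 := by gcongr
  have h12 : ((2 / 1.1 : ℝ) ^ d) ^ 4 * (1 / 1.1) ^ d < 4 ^ d * ((1 + 1 / 4) ^ 4) ^ d :=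
    lt_of_lt_of_le (by gcongr) h4
  rw [← pow_mul, mul_comm d 4, pow_mul, ← mul_pow, ← mul_pow] at h12
  -- Numerically, `(2 / 1.1)^4 / 1.1 ≈ 9.93` exceeds `4 * 1.25^4 ≈ 9.77`.
  exact absurd h12 (not_lt.2 (pow_le_pow_left₀ (by norm_num) (by norm_num) d))

theorem mainTheorem1 :
    ∃ C : ℝ, 0 < C ∧ ∀ d : ℕ, 1 ≤ d →
      ¬ (hypercube d).IsMinorUniversal (C * 2 ^ d / d) := by
  -- `512 = 2 * 4 * 64`: four matchings, and a factor 2 absorbing the rounding up of `2^d / d`.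
  refine ⟨512, by norm_num, fun d hd h => ?_⟩
  have hlt : 2 ^ d < d * (2 ^ d / d + 1) := Nat.lt_mul_div_succ _ hd
  refine not_forall_hasMinor_permGraph (d := d) (n := 64 * (2 ^ d / d + 1)) (by simp)
    (by nlinarith) fun σ => h _ _ ?_ (not_isIsolated_permGraph σ)
  rw [le_div_iff₀ (by exact_mod_cast hd)]
  have h1 : (permGraph σ).edgeSet.ncard * d ≤ 512 * 2 ^ d :=
    calc _ ≤ 4 * (64 * (2 ^ d / d + 1)) * d :=
          Nat.mul_le_mul_right _ (ncard_edgeSet_permGraph_le σ)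
      _ = 256 * (2 ^ d / d * d + d) := by ring
      _ ≤ 256 * (2 ^ d + 2 ^ d) := by
          gcongr
          · exact Nat.div_mul_le_self _ _
          · exact Nat.lt_two_pow_self.le
      _ = 512 * 2 ^ d := by ring
  exact_mod_cast h1
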